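/- Let $0<e<1$ and $E=\frac{8}{1-e^2}$. For $v,w\in\mathbb R^3$ and $\sigma\in S^2$ put $$v'=\tfrac12(v+w)+\tfrac{1-e}{4}(v-w)+\tfrac{1+e}{4}|v-w|\sigma ,$$ and for a Borel probability measure $f$ on $\mathbb R^3$ and a bounded continuous $\varphi:\mathbb R^3\to\mathbb R$ let $$(\varphi,Q(f,f))=\frac1{4\pi}\int_{\mathbb R^3}\int_{\mathbb R^3}\int_{S^2}\bigl[\varphi(v')-\varphi(v)\bigr]\,d\sigma\,df(w)\,df(v).$$ A solution of $\frac{\partial f}{\partial\tau}=E\,Q(f,f)$ with initial datum $f^0$ is a weakly continuous family $(f(\tau))_{\tau\ge0}$ of Borel probability measures on $\mathbb R^3$ with $f(0)=f^0$ such that, for every bounded continuous $\varphi$ and every $\tau>0$, $\frac{d}{d\tau}\int\varphi\,df(\tau)=E\,(\varphi,Q(f(\tau),f(\tau)))$. Let $\mathcal P_2(\mathbb R^3)$ be the set of Borel probability measures on $\mathbb R^3$ with finite second moment, let $\langle f\rangle=\int v\,df(v)$ be the mean velocity, and let $W_2(f,g)=\inf_\pi\bigl(\iint|v-w|^2\,d\pi(v,w)\bigr)^{1/2}$,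 where $\pi$ runs over the probability measures on $\mathbb R^3\times\mathbb R^3$ with marginals $f$ and $g$. **Theorem.** Let $f_1,f_2$ be two solutions of $\frac{\partial f}{\partial\tau}=E\,Q(f,f)$ with respective initial data $f_1^0,f_2^0\in\mathcal P_2(\mathbb R^3)$. Then, for all $\tau\ge0$, $f_1(\tau),f_2(\tau)\in\mathcal P_2(\mathbb R^3)$ and $$W_2^2(f_1(\tau),f_2(\tau))\le e^{-2\tau}\,W_2^2(f_1^0,f_2^0)+(1-e^{-2\tau})\,\bigl|\langle f_1^0\rangle-\langle f_2^0\rangle\bigr|^2 ,$$ where in $e^{-2\tau}$ the letter $e$ denotes the base of the natural logarithm, not the restitution coefficient. -/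

import Mathlib

open MeasureTheory Set
open scoped ENNReal BoundedContinuousFunction

noncomputable section

namespace InelasticMaxwell

/-- The velocity space `ℝ³` with its Euclidean norm. -/
abbrev Vel : Type := EuclideanSpace ℝ (Fin 3)

/-- The unit sphere `S²` of `ℝ³`. -/
abbrev S2 : Type := Metric.sphere (0 : Vel) 1

/-- The surface measure `dσ` on `S²`, of total mass `4π`. -/
def surface : Measure S2 := (volume : Measure Vel).toSphere

/-- The postcollisional velocity
`v' = (v + w)/2 + (1 - e)/4 (v - w) + (1 + e)/4 |v - w| σ`. -/
def postVel (e : ℝ) (v w : Vel) (σ : S2) : Vel :=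
  (1 / 2 : ℝ) • (v + w) + ((1 - e) / 4) • (v - w) + ((1 + e) / 4 * ‖v - w‖) • (σ : Vel)

/-- The action `(φ, Q(f,f))` of the collision operator on a test function:
`1/(4π) ∫_{ℝ³} ∫_{ℝ³} ∫_{S²} [φ(v') - φ(v)] dσ df(w) df(v)`. -/
def collision (e : ℝ) (f : Measure Vel) (φ : Vel → ℝ) : ℝ :=
  (1 / (4 * Real.pi)) *
    ∫ v, ∫ w, ∫ σ, (φ (postVel e v w σ) - φ v) ∂surface ∂f ∂f

/-- The constant `E = 8 / (1 - e²)`. -/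
def rate (e : ℝ) : ℝ := 8 / (1 - e ^ 2)

/-- `f` has a finite second moment; for a Borel probability measure this is membership in
`P₂(ℝ³)`. -/
def FiniteEnergy (f : Measure Vel) : Prop := ∫⁻ v, ‖v‖ₑ ^ 2 ∂f < ∞

/-- The mean velocity `⟨f⟩ = ∫ v df(v)`. -/
def meanVel (f : Measure Vel) : Vel := ∫ v, v ∂f

/-- `π` is a coupling (transport plan) of `f` and `g`: its marginals are `f` and `g`. -/
def IsCoupling (π : Measure (Vel × Vel)) (f g : Measure Vel) : Prop :=
  π.map Prod.fst = f ∧ π.map Prod.snd = g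

/-- The quadratic Wasserstein distance
`W₂(f, g) = inf { ∬ |v - w|² dπ(v, w) }^{1/2}` over the couplings of `f` and `g`, with values in
`[0, ∞]`; it is finite on `P₂(ℝ³)`. -/
def W2 (f g : Measure Vel) : ℝ≥0∞ :=
  (⨅ (π : Measure (Vel × Vel)) (_ : IsCoupling π f g),
    ∫⁻ p, ‖p.1 - p.2‖ₑ ^ 2 ∂π) ^ (1 / 2 : ℝ)

/-- `τ ↦ f τ`, `τ ≥ 0`, is a (measure-valued) solution of `∂f/∂τ = E Q(f,f)` with initial datum
`f₀`: a curve of Borel probability measures, continuous for the weak topology of probability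
measures, with `f 0 = f₀`, satisfying
`d/dτ (φ, f τ) = E (φ, Q(f τ, f τ))` for `τ > 0` against every bounded continuous `φ`.
The values `f τ` for `τ < 0` are irrelevant. No moment is assumed finite. -/
structure IsSolution (e : ℝ) (f₀ : ProbabilityMeasure Vel) (f : ℝ → ProbabilityMeasure Vel) :
    Prop where
  initial : f 0 = f₀
  continuousOn : ContinuousOn f (Ici 0)
  evolution : ∀ φ : Vel →ᵇ ℝ, ∀ τ : ℝ, 0 < τ →
    HasDerivAt (fun s : ℝ => ∫ v, φ v ∂(f s : Measure Vel))
      (rate e * collision e (f τ : Measure Vel) φ) τ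

end InelasticMaxwell

end

/-!
Write `a = (3 - e)/4`, `b = (1 + e)/4`, so that `a + b = 1` and
`v' = a v + b w + b |v - w| σ`. Dividing by `4π`, the equation reads `∂f/∂τ = E (Q⁺(f, f) - f)`,
where `Q⁺(μ, ν)` (here `gain`) is the law of `v'` for independent `v ∼ μ`, `w ∼ ν` and `σ` uniform
on the sphere.

*Solutions are Wild sums.* Set `W₀ = f⁰` and `W_{n+1} = (n+1)⁻¹ ∑_{k ≤ n} Q⁺(W_k, W_{n-k})`. Every
solution equals `∑_n e^{-Eτ} (1 - e^{-Eτ})ⁿ W_n`, whatever its moments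
(`IsGainSolution.eq_wildSum`): since `Q⁺` is bilinear and monotone, comparing the derivatives of
`e^{Eτ} ∫ φ df(τ)` for `φ ≥ 0` shows inductively that the partial sums of the series are bounded
above by `f(τ)`, and the series already has total mass one.

*Coupling.* Given a coupling `π` of the two initial data, let pairs of particles collide with a
common `σ` (`pairVel`). The Wild sum of `π` for this dynamics has the two solutions as marginals,
so it is a coupling of them, and only its cost has to be bounded; the infimum over `π` is taken at
the very end, and no optimal coupling is needed.

*One collision.* With `A = v - x`, `B = w - y`, averaging over the common `σ` gives
`|v' - x'|² ≤ |a A + b B|² + b² |A - B|²`, whose expectation for independent pairs with mean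
difference `D` is `(a² + b²) 𝔼|A|² + 2 b² 𝔼|B|² + κ |D|²`, where `κ = (1 - e²)/4` and
`a² + 3 b² = 1 - κ` (`lintegral_cost_gain_le`). The means are conserved, so `D` is the same for all
Wild terms.

*Summation.* The costs `m_n` of the Wild terms thus satisfy
`(n+1) m_{n+1} ≤ (1 - κ) ∑_{k ≤ n} m_k + (n+1) κ |D|²`. The solution of the corresponding equality
is given by the coefficients of `(1 - z)^{κ - 1}`, so at `z = 1 - e^{-Eτ}` the series sums to
`e^{-κEτ} m₀ + (1 - e^{-κEτ}) |D|²`, and `κ E = 2`.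
-/

open scoped NNReal Pointwise

noncomputable section

namespace InelasticMaxwell

/-! ### The gain operator and the Wild sum -/

section Gain

variable {X Y S : Type*} [MeasurableSpace X] [MeasurableSpace Y] [MeasurableSpace S]

/-- The bilinear gain operator `Q⁺(μ, ν)` of a collision rule `C`: the law of `C v w σ` for
independent `v ∼ μ`, `w ∼ ν` and `σ ∼ U`. -/
def gain (U : Measure S) (C : X → X → S → X) (μ ν : Measure X) : Measure X :=
  ((μ.prod ν).prod U).map fun p => C p.1.1 p.1.2 p.2

variable {U : Measure S} {C : X → X → S → X} {D : Y → Y → S → Y}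

lemma lintegral_gain [SFinite U] (hC : Measurable fun p : (X × X) × S => C p.1.1 p.1.2 p.2)
    (μ ν : Measure X) [SFinite ν] {g : X → ℝ≥0∞} (hg : Measurable g) :
    ∫⁻ x, g x ∂(gain U C μ ν) = ∫⁻ v, ∫⁻ w, ∫⁻ σ, g (C v w σ) ∂U ∂ν ∂μ := by
  have h : Measurable fun p : (X × X) × S => g (C p.1.1 p.1.2 p.2) := hg.comp hC
  rw [gain, lintegral_map hg hC, lintegral_prod _ h.aemeasurable,
    lintegral_prod _ h.lintegral_prod_right'.aemeasurable]

lemma isProbabilityMeasure_gain [IsProbabilityMeasure U]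
    (hC : Measurable fun p : (X × X) × S => C p.1.1 p.1.2 p.2)
    (μ ν : Measure X) [IsProbabilityMeasure μ] [IsProbabilityMeasure ν] :
    IsProbabilityMeasure (gain U C μ ν) :=
  Measure.isProbabilityMeasure_map hC.aemeasurable

lemma gain_mono [SFinite U] (hC : Measurable fun p : (X × X) × S => C p.1.1 p.1.2 p.2)
    {μ μ' ν ν' : Measure X} [SFinite ν'] (h : μ ≤ μ') (h' : ν ≤ ν') :
    gain U C μ ν ≤ gain U C μ' ν' :=
  Measure.map_mono (Measure.prod_mono (Measure.prod_mono h h') le_rfl) hC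

/-- The gain operator commutes with a map `h` that intertwines two collision rules. -/
lemma gain_map [SFinite U] (hC : Measurable fun p : (X × X) × S => C p.1.1 p.1.2 p.2)
    (hD : Measurable fun p : (Y × Y) × S => D p.1.1 p.1.2 p.2)
    {h : X → Y} (hh : Measurable h) (hCD : ∀ v w σ, h (C v w σ) = D (h v) (h w) σ)
    (μ ν : Measure X) [SFinite μ] [SFinite ν] :
    (gain U C μ ν).map h = gain U D (μ.map h) (ν.map h) := by
  have hU : U = U.map id := by simp
  rw [gain, gain, Measure.map_map hh hC, Measure.map_prod_map _ _ hh hh]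
  conv_rhs => rw [hU]
  rw [Measure.map_prod_map _ _ (hh.prodMap hh) measurable_id,
    Measure.map_map hD ((hh.prodMap hh).prodMap measurable_id)]
  congr 1
  ext p
  exact hCD _ _ _

lemma lintegral_gain_sum [SFinite U] (hC : Measurable fun p : (X × X) × S => C p.1.1 p.1.2 p.2)
    (s : Finset ℕ) (c : ℕ → ℝ≥0∞) (μ : ℕ → Measure X)
    [∀ n, SFinite (μ n)] {g : X → ℝ≥0∞} (hg : Measurable g) :
    ∫⁻ x, g x ∂(gain U C (∑ k ∈ s, c k • μ k) (∑ k ∈ s, c k • μ k)) =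
      ∑ k ∈ s, ∑ l ∈ s, c k * c l * ∫⁻ x, g x ∂(gain U C (μ k) (μ l)) := by
  have h : Measurable fun p : (X × X) × S => g (C p.1.1 p.1.2 p.2) := hg.comp hC
  have h1 (ν : Measure X) : Measurable fun p : X × X => ∫⁻ σ, g (C p.1 p.2 σ) ∂U :=
    h.lintegral_prod_right'
  have h2 (ν : Measure X) [SFinite ν] : Measurable fun v => ∫⁻ w, ∫⁻ σ, g (C v w σ) ∂U ∂ν :=
    (h1 ν).lintegral_prod_right'
  have hs : SFinite (∑ k ∈ s, c k • μ k) :=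
    Finset.sum_induction _ SFinite (fun _ _ _ _ => inferInstance) inferInstance
      fun _ _ => inferInstance
  rw [lintegral_gain hC _ _ hg]
  simp_rw [lintegral_gain hC _ _ hg, lintegral_finsetSum_measure, lintegral_smul_measure,
    smul_eq_mul]
  refine Finset.sum_congr rfl fun k _ => ?_
  rw [lintegral_finsetSum _ fun l _ => (h2 (μ l)).const_mul (c l), Finset.mul_sum]
  refine Finset.sum_congr rfl fun l _ => ?_
  rw [lintegral_const_mul _ (h2 (μ l)), mul_assoc]

/-- The terms of the Wild sum with initial datum `μ₀`: `W₀ = μ₀` and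
`W_{n+1} = (n+1)⁻¹ ∑_{k ≤ n} Q⁺(W_k, W_{n-k})`. -/
def wild (U : Measure S) (C : X → X → S → X) (μ₀ : Measure X) : ℕ → Measure X
  | 0 => μ₀
  | n + 1 => ((n + 1 : ℕ) : ℝ≥0∞)⁻¹ •
      ∑ k : Fin (n + 1), gain U C (wild U C μ₀ k) (wild U C μ₀ (n - k))

lemma wild_zero (μ₀ : Measure X) : wild U C μ₀ 0 = μ₀ := by rw [wild]

lemma wild_succ (μ₀ : Measure X) (n : ℕ) :
    wild U C μ₀ (n + 1) = ((n + 1 : ℕ) : ℝ≥0∞)⁻¹ •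
      ∑ k ∈ Finset.range (n + 1), gain U C (wild U C μ₀ k) (wild U C μ₀ (n - k)) := by
  rw [wild, Finset.sum_range]

lemma isProbabilityMeasure_wild [IsProbabilityMeasure U]
    (hC : Measurable fun p : (X × X) × S => C p.1.1 p.1.2 p.2)
    (μ₀ : Measure X) [IsProbabilityMeasure μ₀] (n : ℕ) :
    IsProbabilityMeasure (wild U C μ₀ n) := by
  induction n using Nat.strong_induction_on with
  | _ n ih =>
    cases n with
    | zero => rwa [wild_zero]
    | succ n =>
      constructor
      have h : ∀ k ∈ Finset.range (n + 1),
          gain U C (wild U C μ₀ k) (wild U C μ₀ (n - k)) univ = 1 := by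
        intro k hk
        have := ih k (by simpa using hk)
        have := ih (n - k) (by omega)
        have := isProbabilityMeasure_gain (U := U) hC (wild U C μ₀ k) (wild U C μ₀ (n - k))
        exact measure_univ
      rw [wild_succ, Measure.smul_apply, Measure.finsetSum_apply, Finset.sum_congr rfl h]
      simp only [Finset.sum_const, Finset.card_range, nsmul_eq_mul, mul_one, smul_eq_mul]
      exact ENNReal.inv_mul_cancel (by simp) (by simp)

lemma wild_map [IsProbabilityMeasure U]
    (hC : Measurable fun p : (X × X) × S => C p.1.1 p.1.2 p.2)
    (hD : Measurable fun p : (Y × Y) × S => D p.1.1 p.1.2 p.2)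
    {h : X → Y} (hh : Measurable h) (hCD : ∀ v w σ, h (C v w σ) = D (h v) (h w) σ)
    (μ₀ : Measure X) [IsProbabilityMeasure μ₀] (n : ℕ) :
    (wild U C μ₀ n).map h = wild U D (μ₀.map h) n := by
  have := isProbabilityMeasure_wild (U := U) hC μ₀
  induction n using Nat.strong_induction_on with
  | _ n ih =>
    cases n with
    | zero => rw [wild_zero, wild_zero]
    | succ n =>
      rw [wild_succ, wild_succ, Measure.map_smul, Measure.map_finset_sum hh.aemeasurable]
      congr 1
      refine Finset.sum_congr rfl fun k hk => ?_
      rw [gain_map hC hD hh hCD, ih k (by simpa using hk), ih (n - k) (by omega)]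

lemma lintegral_wild_succ (μ₀ : Measure X) (n : ℕ) (g : X → ℝ≥0∞) :
    ∫⁻ x, g x ∂(wild U C μ₀ (n + 1)) = ((n + 1 : ℕ) : ℝ≥0∞)⁻¹ *
      ∑ k ∈ Finset.range (n + 1), ∫⁻ x, g x ∂(gain U C (wild U C μ₀ k) (wild U C μ₀ (n - k))) := by
  rw [wild_succ, lintegral_smul_measure, lintegral_finsetSum_measure, smul_eq_mul]

end Gain

section Weights

/-- The weight `e^{-Eτ} (1 - e^{-Eτ})ⁿ` of the `n`-th Wild term at time `τ`. -/
def wildWeight (E τ : ℝ) (n : ℕ) : ℝ := Real.exp (-(E * τ)) * (1 - Real.exp (-(E * τ))) ^ n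

lemma wildWeight_base_mem {E τ : ℝ} (hE : 0 ≤ E) (hτ : 0 ≤ τ) :
    1 - Real.exp (-(E * τ)) ∈ Ico (0 : ℝ) 1 := by
  have h1 : Real.exp (-(E * τ)) ≤ 1 := Real.exp_le_one_iff.2 (by have := mul_nonneg hE hτ; linarith)
  have h2 := Real.exp_pos (-(E * τ))
  constructor <;> linarith

lemma wildWeight_nonneg {E τ : ℝ} (hE : 0 ≤ E) (hτ : 0 ≤ τ) (n : ℕ) : 0 ≤ wildWeight E τ n :=
  mul_nonneg (Real.exp_pos _).le (pow_nonneg (wildWeight_base_mem hE hτ).1 n)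

lemma hasSum_wildWeight {E τ : ℝ} (hE : 0 ≤ E) (hτ : 0 ≤ τ) : HasSum (wildWeight E τ) 1 := by
  obtain ⟨h0, h1⟩ := wildWeight_base_mem hE hτ
  have h := (hasSum_geometric_of_lt_one h0 h1).mul_left (Real.exp (-(E * τ)))
  rwa [sub_sub_cancel, mul_inv_cancel₀ (Real.exp_pos _).ne'] at h

variable {X S : Type*} [MeasurableSpace X] [MeasurableSpace S]

/-- The Wild sum `∑_n e^{-Eτ} (1 - e^{-Eτ})ⁿ W_n`. The weights enter through `ENNReal.ofReal`, so
it is meaningful only for `E τ ≥ 0`. -/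
def wildSum (U : Measure S) (C : X → X → S → X) (E : ℝ) (μ₀ : Measure X) (τ : ℝ) : Measure X :=
  Measure.sum fun n => ENNReal.ofReal (wildWeight E τ n) • wild U C μ₀ n

lemma lintegral_wildSum (U : Measure S) (C : X → X → S → X) (E : ℝ) (μ₀ : Measure X) (τ : ℝ)
    (g : X → ℝ≥0∞) :
    ∫⁻ x, g x ∂(wildSum U C E μ₀ τ) =
      ∑' n, ENNReal.ofReal (wildWeight E τ n) * ∫⁻ x, g x ∂(wild U C μ₀ n) := by
  simp_rw [wildSum, lintegral_sum_measure, lintegral_smul_measure, smul_eq_mul]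

lemma tsum_ofReal_wildWeight {E τ : ℝ} (hE : 0 ≤ E) (hτ : 0 ≤ τ) :
    ∑' n, ENNReal.ofReal (wildWeight E τ n) = 1 := by
  rw [← ENNReal.ofReal_tsum_of_nonneg (wildWeight_nonneg hE hτ) (hasSum_wildWeight hE hτ).summable,
    (hasSum_wildWeight hE hτ).tsum_eq, ENNReal.ofReal_one]

variable {U : Measure S} {C : X → X → S → X}

lemma isProbabilityMeasure_wildSum [IsProbabilityMeasure U]
    (hC : Measurable fun p : (X × X) × S => C p.1.1 p.1.2 p.2) {E τ : ℝ} (hE : 0 ≤ E) (hτ : 0 ≤ τ)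
    (μ₀ : Measure X) [IsProbabilityMeasure μ₀] : IsProbabilityMeasure (wildSum U C E μ₀ τ) := by
  have := isProbabilityMeasure_wild (U := U) hC μ₀
  constructor
  have h := lintegral_wildSum U C E μ₀ τ 1
  simpa [tsum_ofReal_wildWeight hE hτ] using h

lemma wildSum_map {Y : Type*} [MeasurableSpace Y] {D : Y → Y → S → Y} [IsProbabilityMeasure U]
    (hC : Measurable fun p : (X × X) × S => C p.1.1 p.1.2 p.2)
    (hD : Measurable fun p : (Y × Y) × S => D p.1.1 p.1.2 p.2)
    {h : X → Y} (hh : Measurable h) (hCD : ∀ v w σ, h (C v w σ) = D (h v) (h w) σ)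
    (E τ : ℝ) (μ₀ : Measure X) [IsProbabilityMeasure μ₀] :
    (wildSum U C E μ₀ τ).map h = wildSum U D E (μ₀.map h) τ := by
  simp_rw [wildSum, Measure.map_sum hh.aemeasurable, Measure.map_smul,
    wild_map hC hD hh hCD]

end Weights

/-! ### Solutions are Wild sums -/

section Uniqueness

variable {X S : Type*} [MeasurableSpace X] [MeasurableSpace S] [PseudoMetricSpace X] [BorelSpace X]

/-- Bounded continuous functions detect the order of finite measures: compare closed sets through
their thickened indicators, then use inner regularity. -/
lemma measure_le_of_forall_lintegral_le {μ ν : Measure X} [IsFiniteMeasure μ] [IsFiniteMeasure ν]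
    (h : ∀ φ : X →ᵇ ℝ≥0, ∫⁻ x, φ x ∂μ ≤ ∫⁻ x, φ x ∂ν) : μ ≤ ν := by
  have hF (F : Set X) (hF : IsClosed F) : μ F ≤ ν F :=
    ge_of_tendsto' (tendsto_lintegral_thickenedIndicator_of_isClosed ν hF
      (δs := fun n : ℕ => 1 / ((n : ℝ) + 1)) (fun n => Nat.one_div_pos_of_nat)
      tendsto_one_div_add_atTop_nhds_zero_nat) fun n =>
      (measure_le_lintegral_thickenedIndicator μ hF.measurableSet _).trans (h _)
  refine Measure.le_iff.2 fun A hA => ?_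
  rw [hA.measure_eq_iSup_isClosed_of_ne_top (measure_ne_top μ A)]
  exact iSup₂_le fun F hFA => iSup_le fun hFc => (hF F hFc).trans (measure_mono hFA)

variable {U : Measure S} {C : X → X → S → X}

/-- `f` is a weakly continuous solution of `∂f/∂τ = E (Q⁺(f, f) - f)`, tested against bounded
continuous functions. -/
structure IsGainSolution (U : Measure S) (C : X → X → S → X) (E : ℝ)
    (f : ℝ → ProbabilityMeasure X) : Prop where
  continuousOn : ContinuousOn f (Ici 0)
  evolution : ∀ φ : X →ᵇ ℝ, ∀ τ : ℝ, 0 < τ →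
    HasDerivAt (fun s : ℝ => ∫ v, φ v ∂(f s : Measure X))
      (E * (∫ x, φ x ∂(gain U C (f τ) (f τ)) - ∫ x, φ x ∂(f τ : Measure X))) τ

lemma sum_range_antidiagonal_le (h : ℕ → ℕ → ℝ) (hh : ∀ k l, 0 ≤ h k l) (N : ℕ) :
    ∑ n ∈ Finset.range N, ∑ k ∈ Finset.range (n + 1), h k (n - k) ≤
      ∑ k ∈ Finset.range N, ∑ l ∈ Finset.range N, h k l := by
  rw [Finset.sum_range_diag_flip]
  gcongr with k hk
  · exact fun _ _ _ => hh _ _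
  · exact Nat.sub_le N k

lemma ofReal_integral_coe_nnreal (μ : Measure X) [IsFiniteMeasure μ] (φ : X →ᵇ ℝ≥0) :
    ENNReal.ofReal (∫ x, (φ x : ℝ) ∂μ) = ∫⁻ x, φ x ∂μ := by
  rw [ofReal_integral_eq_lintegral_ofReal]
  · simp
  · exact BoundedContinuousFunction.integrable_of_nnreal μ φ
  · exact Filter.Eventually.of_forall fun _ => NNReal.coe_nonneg _

/-- Monotonicity and bilinearity of the gain operator, on a measure that dominates a finite
nonnegative combination. -/
lemma integral_gain_ge [IsProbabilityMeasure U]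
    (hC : Measurable fun p : (X × X) × S => C p.1.1 p.1.2 p.2)
    (W : ℕ → Measure X) [∀ n, IsProbabilityMeasure (W n)]
    (f : Measure X) [IsProbabilityMeasure f] (N : ℕ) (c : ℕ → ℝ) (hc : ∀ n, 0 ≤ c n)
    (h : ∑ n ∈ Finset.range N, ENNReal.ofReal (c n) • W n ≤ f) (φ : X →ᵇ ℝ≥0) :
    ∑ k ∈ Finset.range N, ∑ l ∈ Finset.range N,
      c k * c l * ∫ x, (φ x : ℝ) ∂(gain U C (W k) (W l)) ≤
    ∫ x, (φ x : ℝ) ∂(gain U C f f) := by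
  have hg (μ ν : Measure X) [IsProbabilityMeasure μ] [IsProbabilityMeasure ν] :=
    isProbabilityMeasure_gain (U := U) hC μ ν
  have hi (μ : Measure X) : 0 ≤ ∫ x, (φ x : ℝ) ∂μ :=
    integral_nonneg fun x => NNReal.coe_nonneg _
  rw [← ENNReal.ofReal_le_ofReal_iff (hi _), ofReal_integral_coe_nnreal]
  refine le_trans (le_of_eq ?_) (lintegral_mono' (gain_mono (U := U) hC h h) le_rfl)
  rw [lintegral_gain_sum hC _ _ _ (by fun_prop), ENNReal.ofReal_sum_of_nonneg]
  · refine Finset.sum_congr rfl fun k _ => ?_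
    rw [ENNReal.ofReal_sum_of_nonneg]
    · refine Finset.sum_congr rfl fun l _ => ?_
      rw [ENNReal.ofReal_mul (mul_nonneg (hc _) (hc _)), ENNReal.ofReal_mul (hc _),
        ofReal_integral_coe_nnreal]
    · exact fun l _ => mul_nonneg (mul_nonneg (hc _) (hc _)) (hi _)
  · exact fun k _ => Finset.sum_nonneg fun l _ => mul_nonneg (mul_nonneg (hc _) (hc _)) (hi _)

lemma integral_wild_succ [IsProbabilityMeasure U]
    (hC : Measurable fun p : (X × X) × S => C p.1.1 p.1.2 p.2)
    (μ₀ : Measure X) [IsProbabilityMeasure μ₀] (n : ℕ) (φ : X →ᵇ ℝ≥0) :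
    ((n + 1 : ℕ) : ℝ) * ∫ x, (φ x : ℝ) ∂(wild U C μ₀ (n + 1)) =
      ∑ k ∈ Finset.range (n + 1),
        ∫ x, (φ x : ℝ) ∂(gain U C (wild U C μ₀ k) (wild U C μ₀ (n - k))) := by
  have := isProbabilityMeasure_wild (U := U) hC μ₀
  have hg (μ ν : Measure X) [IsProbabilityMeasure μ] [IsProbabilityMeasure ν] :=
    isProbabilityMeasure_gain (U := U) hC μ ν
  rw [wild_succ, integral_smul_measure, integral_finsetSum_measure]
  · have : ((n + 1 : ℕ) : ℝ) ≠ 0 := by positivity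
    rw [ENNReal.toReal_inv, ENNReal.toReal_natCast, smul_eq_mul, mul_inv_cancel_left₀ this]
  · exact fun k _ => BoundedContinuousFunction.integrable_of_nnreal _ φ

/-- The partial Wild sums lie below every solution. Comparing derivatives, `e^{Eτ} ∫ φ df(τ)` grows
at least as fast as `∑_{n ≤ N} zⁿ ∫ φ dW_n` with `z = 1 - e^{-Eτ}`, because by induction `f(τ)`
dominates the partial sum of length `N`, hence `Q⁺(f(τ), f(τ))` its self-interaction. -/
theorem IsGainSolution.partialSum_le [IsProbabilityMeasure U]
    (hC : Measurable fun p : (X × X) × S => C p.1.1 p.1.2 p.2) {E : ℝ} (hE : 0 ≤ E)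
    {f : ℝ → ProbabilityMeasure X} (hf : IsGainSolution U C E f) (N : ℕ) :
    ∀ τ : ℝ, 0 ≤ τ → ∑ n ∈ Finset.range N, ENNReal.ofReal (wildWeight E τ n) •
      wild U C (f 0 : Measure X) n ≤ (f τ : Measure X) := by
  have hW := isProbabilityMeasure_wild (U := U) hC (f 0 : Measure X)
  have hg (μ ν : Measure X) [IsProbabilityMeasure μ] [IsProbabilityMeasure ν] :=
    isProbabilityMeasure_gain (U := U) hC μ ν
  set W := wild U C (f 0 : Measure X) with hWdef
  induction N with
  | zero => intro τ _; simpa using Measure.zero_le _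
  | succ N ih =>
    intro τ hτ
    have hfin : IsFiniteMeasure
        (∑ n ∈ Finset.range (N + 1), ENNReal.ofReal (wildWeight E τ n) • W n) := by
      constructor
      simp [Measure.finsetSum_apply, ENNReal.sum_lt_top]
    refine measure_le_of_forall_lintegral_le fun φ => ?_
    -- `ψ` is `φ` with real values, as the weak formulation requires
    let ψ : X →ᵇ ℝ := φ.comp _ NNReal.isometry_coe.lipschitz
    let a (n : ℕ) : ℝ := ∫ x, (φ x : ℝ) ∂(W n)
    let b (k l : ℕ) : ℝ := ∫ x, (φ x : ℝ) ∂(gain U C (W k) (W l))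
    have hb (k l : ℕ) : 0 ≤ b k l := integral_nonneg fun x => NNReal.coe_nonneg _
    let m (s : ℝ) : ℝ := ∫ x, (φ x : ℝ) ∂(f s : Measure X)
    let G (s : ℝ) : ℝ := ∑ n ∈ Finset.range (N + 1), (1 - Real.exp (-(E * s))) ^ n * a n
    let H (s : ℝ) : ℝ := Real.exp (E * s) * m s - G s
    have hz (s : ℝ) : HasDerivAt (fun s => 1 - Real.exp (-(E * s)))
        (E * Real.exp (-(E * s))) s := by
      have h := (((hasDerivAt_id s).const_mul E).fun_neg.exp).const_sub 1
      simpa [mul_comm] using h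
    have hG (s : ℝ) : HasDerivAt G (E * Real.exp (-(E * s)) * ∑ n ∈ Finset.range N,
        (1 - Real.exp (-(E * s))) ^ n * ∑ k ∈ Finset.range (n + 1), b k (n - k)) s := by
      have h : HasDerivAt G _ s :=
        HasDerivAt.fun_sum fun n (_ : n ∈ Finset.range (N + 1)) => ((hz s).pow n).mul_const (a n)
      convert h using 1
      rw [Finset.sum_range_succ', Finset.mul_sum]
      simp only [Nat.cast_zero, zero_mul, add_zero, Nat.add_sub_cancel]
      refine Finset.sum_congr rfl fun n _ => ?_
      have := integral_wild_succ (U := U) hC (f 0 : Measure X) n φ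
      rw [← this]
      ring
    have hm (s : ℝ) (hs : 0 < s) : HasDerivAt m
        (E * (∫ x, (φ x : ℝ) ∂(gain U C (f s) (f s)) - m s)) s := hf.evolution ψ s hs
    have hmc : ContinuousOn m (Ici 0) :=
      (ProbabilityMeasure.continuous_integral_boundedContinuousFunction ψ).comp_continuousOn
        hf.continuousOn
    have hH (s : ℝ) (hs : 0 < s) : HasDerivAt H
        (E * Real.exp (E * s) * ∫ x, (φ x : ℝ) ∂(gain U C (f s) (f s)) -
          E * Real.exp (-(E * s)) * ∑ n ∈ Finset.range N,
        (1 - Real.exp (-(E * s))) ^ n * ∑ k ∈ Finset.range (n + 1), b k (n - k)) s := by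
      have h : HasDerivAt H _ s :=
        ((((hasDerivAt_id s).const_mul E).exp).fun_mul (hm s hs)).fun_sub (hG s)
      convert h using 1
      simp only [id]
      ring
    have hmono : MonotoneOn H (Ici 0) := by
      refine monotoneOn_of_deriv_nonneg (convex_Ici 0) ?_ ?_ ?_
      · exact ((by fun_prop : Continuous fun s => Real.exp (E * s)).continuousOn.mul hmc).sub
          (by fun_prop)
      · rw [interior_Ici]
        exact fun s hs => (hH s hs).differentiableAt.differentiableWithinAt
      · rw [interior_Ici]
        intro s hs
        have hs' : 0 ≤ s := le_of_lt hs
        rw [(hH s hs).deriv, sub_nonneg, mul_assoc, mul_assoc]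
        refine mul_le_mul_of_nonneg_left ?_ hE
        have hz0 := (wildWeight_base_mem hE hs').1
        set z := 1 - Real.exp (-(E * s)) with hzdef
        have h1 := integral_gain_ge (U := U) hC W (f s : Measure X) N (wildWeight E s)
          (wildWeight_nonneg hE hs') (ih s hs') φ
        -- the terms with `k + l < N` are part of the full double sum over `k, l < N`
        have h2 := sum_range_antidiagonal_le (fun k l => z ^ (k + l) * b k l)
          (fun k l => mul_nonneg (pow_nonneg hz0 _) (hb k l)) N
        have h3 : ∑ n ∈ Finset.range N, z ^ n * ∑ k ∈ Finset.range (n + 1), b k (n - k) =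
            ∑ n ∈ Finset.range N, ∑ k ∈ Finset.range (n + 1),
              z ^ (k + (n - k)) * b k (n - k) := by
          refine Finset.sum_congr rfl fun n _ => ?_
          rw [Finset.mul_sum]
          refine Finset.sum_congr rfl fun k hk => ?_
          rw [Nat.add_sub_cancel' (by simpa [Nat.lt_succ_iff] using hk)]
        have h4 : ∑ k ∈ Finset.range N, ∑ l ∈ Finset.range N,
            wildWeight E s k * wildWeight E s l * b k l = Real.exp (-(E * s)) ^ 2 *
              ∑ k ∈ Finset.range N, ∑ l ∈ Finset.range N, z ^ (k + l) * b k l := by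
          simp only [wildWeight, Finset.mul_sum]
          refine Finset.sum_congr rfl fun k _ => Finset.sum_congr rfl fun l _ => ?_
          rw [pow_add]
          ring
        have hE1 : Real.exp (E * s) * Real.exp (-(E * s)) = 1 := by rw [← Real.exp_add]; simp
        rw [h3]
        calc _ ≤ Real.exp (-(E * s)) *
              ∑ k ∈ Finset.range N, ∑ l ∈ Finset.range N, z ^ (k + l) * b k l :=
              mul_le_mul_of_nonneg_left h2 (Real.exp_pos _).le
          _ = Real.exp (E * s) * ∑ k ∈ Finset.range N, ∑ l ∈ Finset.range N,
                wildWeight E s k * wildWeight E s l * b k l := by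
              rw [h4]
              linear_combination (-Real.exp (-(E * s)) * (∑ k ∈ Finset.range N,
                ∑ l ∈ Finset.range N, z ^ (k + l) * b k l)) * hE1
          _ ≤ _ := mul_le_mul_of_nonneg_left h1 (Real.exp_pos _).le
    -- at time `0` only the term `n = 0` survives, because `0 ^ 0 = 1`
    have hH0 : H 0 = 0 := by
      simp only [H, G, m, a, mul_zero, Real.exp_zero, neg_zero, sub_self, one_mul]
      rw [Finset.sum_range_succ']
      simp [hWdef, wild_zero]
    have hHτ : 0 ≤ H τ := hH0 ▸ hmono self_mem_Ici hτ hτ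
    have hS : ∫⁻ x, φ x ∂(∑ n ∈ Finset.range (N + 1), ENNReal.ofReal (wildWeight E τ n) • W n) =
        ENNReal.ofReal (Real.exp (-(E * τ)) * G τ) := by
      rw [lintegral_finsetSum_measure, Finset.mul_sum, ENNReal.ofReal_sum_of_nonneg]
      · refine Finset.sum_congr rfl fun n _ => ?_
        rw [lintegral_smul_measure, smul_eq_mul, ← ofReal_integral_coe_nnreal,
          ← ENNReal.ofReal_mul (wildWeight_nonneg hE hτ n), wildWeight, mul_assoc]
      · intro n _
        rw [← mul_assoc]
        exact mul_nonneg (wildWeight_nonneg hE hτ n) (integral_nonneg fun x => NNReal.coe_nonneg _)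
    rw [hS, ← ofReal_integral_coe_nnreal]
    refine ENNReal.ofReal_le_ofReal ?_
    have : Real.exp (E * τ) * Real.exp (-(E * τ)) = 1 := by rw [← Real.exp_add]; simp
    calc Real.exp (-(E * τ)) * G τ ≤ Real.exp (-(E * τ)) * (Real.exp (E * τ) * m τ) := by
          gcongr; exact sub_nonneg.1 hHτ
      _ = m τ := by linear_combination m τ * this

/-- Uniqueness: a solution dominates the Wild sum, and both have mass one. -/
theorem IsGainSolution.eq_wildSum [IsProbabilityMeasure U]
    (hC : Measurable fun p : (X × X) × S => C p.1.1 p.1.2 p.2) {E : ℝ} (hE : 0 ≤ E)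
    {f : ℝ → ProbabilityMeasure X} (hf : IsGainSolution U C E f) {τ : ℝ} (hτ : 0 ≤ τ) :
    (f τ : Measure X) = wildSum U C E (f 0 : Measure X) τ := by
  have := isProbabilityMeasure_wildSum (U := U) hC hE hτ (f 0 : Measure X)
  refine (Measure.eq_of_le_of_isProbabilityMeasure (Measure.le_iff.2 fun A hA => ?_)).symm
  rw [wildSum, Measure.sum_apply _ hA]
  refine ENNReal.tsum_le_of_sum_range_le fun N => ?_
  simpa using hf.partialSum_le hC hE N τ hτ A

end Uniqueness

/-! ### Collisions on the sphere -/

lemma surface_univ : surface univ = ENNReal.ofReal (4 * Real.pi) := by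
  rw [surface, Measure.toSphere_apply_univ, EuclideanSpace.volume_ball_fin_three]
  rw [show ((Module.finrank ℝ Vel : ℕ) : ℝ≥0∞) = ENNReal.ofReal 3 by simp,
    ENNReal.ofReal_one, one_pow, one_mul, ← ENNReal.ofReal_mul (by norm_num)]
  congr 1
  ring

instance : IsFiniteMeasure surface := inferInstanceAs (IsFiniteMeasure (Measure.toSphere _))

/-- The uniform probability measure on `S²`. -/
def unifSphere : Measure S2 := (ENNReal.ofReal (4 * Real.pi))⁻¹ • surface

instance : IsProbabilityMeasure unifSphere := by
  constructor
  rw [unifSphere, Measure.smul_apply, surface_univ, smul_eq_mul]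
  exact ENNReal.inv_mul_cancel (by simp [Real.pi_pos]) ENNReal.ofReal_ne_top

lemma surface_map_neg : surface.map (fun σ => -σ) = surface := by
  ext s hs
  have hm : Measurable fun σ : S2 => -σ := by fun_prop
  rw [Measure.map_apply hm hs, surface, Measure.toSphere_apply' _ hs,
    Measure.toSphere_apply' _ (hm hs)]
  congr 1
  have h : Ioo (0 : ℝ) 1 • ((↑) '' ((fun σ : S2 => -σ) ⁻¹' s) : Set Vel) =
      -(Ioo (0 : ℝ) 1 • ((↑) '' s : Set Vel)) := by
    ext x
    simp only [mem_smul, mem_neg, mem_image, mem_preimage]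
    constructor
    · rintro ⟨r, hr, _, ⟨σ, hσ, rfl⟩, rfl⟩
      exact ⟨r, hr, _, ⟨-σ, hσ, rfl⟩, by simp⟩
    · rintro ⟨r, hr, _, ⟨σ, hσ, rfl⟩, hx⟩
      exact ⟨r, hr, _, ⟨-σ, by simpa using hσ, rfl⟩, by simp [hx]⟩
  rw [h, Measure.measure_neg]

lemma integral_unifSphere_coe : ∫ σ : S2, (σ : Vel) ∂unifSphere = 0 := by
  have h : ∫ σ : S2, (σ : Vel) ∂surface = 0 := by
    -- the antipodal map preserves the surface measure
    have h1 : ∫ σ : S2, (σ : Vel) ∂surface = ∫ σ : S2, ((-σ : S2) : Vel) ∂surface := by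
      conv_lhs => rw [← surface_map_neg]
      exact integral_map (by fun_prop) (by fun_prop)
    simp only [coe_neg_sphere, integral_neg] at h1
    have h2 : (2 : ℝ) • ∫ σ : S2, (σ : Vel) ∂surface = 0 := by
      rw [two_smul]
      nth_rewrite 1 [h1]
      exact neg_add_cancel _
    simpa using h2
  rw [unifSphere, integral_smul_measure, h, smul_zero]

lemma integrable_coe_unifSphere : Integrable (fun σ : S2 => (σ : Vel)) unifSphere :=
  Integrable.of_bound (by fun_prop) 1 (Filter.Eventually.of_forall fun σ => by simp)

lemma integral_surface (g : S2 → ℝ) :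
    ∫ σ, g σ ∂surface = 4 * Real.pi * ∫ σ, g σ ∂unifSphere := by
  have : 4 * Real.pi ≠ 0 := by positivity
  rw [unifSphere, integral_smul_measure, ENNReal.toReal_inv,
    ENNReal.toReal_ofReal (by positivity), smul_eq_mul, mul_inv_cancel_left₀ this]

lemma continuous_postVel (e : ℝ) :
    Continuous fun p : (Vel × Vel) × S2 => postVel e p.1.1 p.1.2 p.2 := by
  unfold postVel
  fun_prop

lemma measurable_postVel (e : ℝ) :
    Measurable fun p : (Vel × Vel) × S2 => postVel e p.1.1 p.1.2 p.2 :=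
  (continuous_postVel e).measurable

/-- The collision operator is `Q⁺(f, f) - f` for the normalized sphere measure. -/
lemma collision_eq (e : ℝ) (f : Measure Vel) [IsProbabilityMeasure f] (φ : Vel →ᵇ ℝ) :
    collision e f φ =
      ∫ v, φ v ∂(gain unifSphere (postVel e) f f) - ∫ v, φ v ∂f := by
  have hπ : 4 * Real.pi ≠ 0 := by positivity
  have hi : Integrable (fun p : (Vel × Vel) × S2 => φ (postVel e p.1.1 p.1.2 p.2))
      ((f.prod f).prod unifSphere) :=
    Integrable.of_bound ((φ.continuous.comp (continuous_postVel e)).aestronglyMeasurable) ‖φ‖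
      (Filter.Eventually.of_forall fun p => φ.norm_coe_le_norm _)
  have hj : Integrable (fun p : (Vel × Vel) × S2 => φ p.1.1) ((f.prod f).prod unifSphere) :=
    Integrable.of_bound (by fun_prop) ‖φ‖
      (Filter.Eventually.of_forall fun p => φ.norm_coe_le_norm _)
  have hk : Integrable (fun p : (Vel × Vel) × S2 => φ (postVel e p.1.1 p.1.2 p.2) - φ p.1.1)
      ((f.prod f).prod unifSphere) := hi.sub hj
  have h1 : ∫ v, ∫ w, ∫ σ, (φ (postVel e v w σ) - φ v) ∂unifSphere ∂f ∂f =
      ∫ p : (Vel × Vel) × S2, (φ (postVel e p.1.1 p.1.2 p.2) - φ p.1.1)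
        ∂((f.prod f).prod unifSphere) := by
    rw [integral_prod _ hk, integral_prod _ hk.integral_prod_left]
  have h2 : ∫ p : (Vel × Vel) × S2, φ p.1.1 ∂((f.prod f).prod unifSphere) = ∫ v, φ v ∂f := by
    rw [integral_prod _ hj, integral_prod _ hj.integral_prod_left]
    simp
  rw [collision]
  simp_rw [integral_surface, integral_const_mul]
  rw [h1, integral_sub hi hj, h2, gain, integral_map (measurable_postVel e).aemeasurable
    (φ.continuous.aestronglyMeasurable), ← mul_assoc, one_div_mul_cancel hπ, one_mul]

theorem IsSolution.isGainSolution {e : ℝ} {f₀ : ProbabilityMeasure Vel}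
    {f : ℝ → ProbabilityMeasure Vel} (hf : IsSolution e f₀ f) :
    IsGainSolution unifSphere (postVel e) (rate e) f where
  continuousOn := hf.continuousOn
  evolution φ τ hτ := by
    have h := hf.evolution φ τ hτ
    rwa [collision_eq] at h

/-- The collision rule for pairs: both components collide with the same direction `σ`. -/
def pairVel (e : ℝ) (P Q : Vel × Vel) (σ : S2) : Vel × Vel :=
  (postVel e P.1 Q.1 σ, postVel e P.2 Q.2 σ)

lemma measurable_pairVel (e : ℝ) :
    Measurable fun p : ((Vel × Vel) × (Vel × Vel)) × S2 => pairVel e p.1.1 p.1.2 p.2 := by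
  unfold pairVel postVel
  fun_prop

lemma integral_norm_add_smul_sq (G : Vel) (r : ℝ) :
    ∫ σ : S2, ‖G + r • (σ : Vel)‖ ^ 2 ∂unifSphere = ‖G‖ ^ 2 + r ^ 2 := by
  have hi : Integrable (fun σ : S2 => 2 * r * inner ℝ G (σ : Vel)) unifSphere :=
    (integrable_coe_unifSphere.const_inner G).const_mul _
  have h (σ : S2) : ‖G + r • (σ : Vel)‖ ^ 2 = (‖G‖ ^ 2 + r ^ 2) + 2 * r * inner ℝ G (σ : Vel) := by
    rw [norm_add_sq_real, norm_smul, inner_smul_right, mul_pow, Real.norm_eq_abs, sq_abs]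
    simp
    ring
  simp_rw [h]
  rw [integral_add (integrable_const _) hi, integral_const_mul,
    integral_inner integrable_coe_unifSphere, integral_unifSphere_coe]
  simp

/-- The cost of one coupled collision, averaged over the common direction. The centres of the two
spheres of outcomes differ by the vector in the first norm, and their radii by at most
`(1 + e)/4 |(v - x) - (w - y)|`. -/
lemma lintegral_enorm_postVel_sub (e : ℝ) (v w x y : Vel) :
    ∫⁻ σ : S2, ‖postVel e v w σ - postVel e x y σ‖ₑ ^ 2 ∂unifSphere ≤
      ENNReal.ofReal (‖((3 - e) / 4) • (v - x) + ((1 + e) / 4) • (w - y)‖ ^ 2 +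
        ((1 + e) / 4) ^ 2 * ‖(v - x) - (w - y)‖ ^ 2) := by
  set G : Vel := ((3 - e) / 4) • (v - x) + ((1 + e) / 4) • (w - y) with hG
  set r : ℝ := (1 + e) / 4 * (‖v - w‖ - ‖x - y‖) with hr
  have h (σ : S2) : postVel e v w σ - postVel e x y σ = G + r • (σ : Vel) := by
    rw [hG, hr, postVel, postVel]
    module
  have h2 (σ : S2) : ‖G + r • (σ : Vel)‖ₑ ^ 2 = ENNReal.ofReal (‖G + r • (σ : Vel)‖ ^ 2) := by
    rw [ENNReal.ofReal_pow (norm_nonneg _), ofReal_norm]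
  simp_rw [h, h2]
  rw [← ofReal_integral_eq_lintegral_ofReal, integral_norm_add_smul_sq]
  · refine ENNReal.ofReal_le_ofReal ?_
    gcongr
    rw [hr, mul_pow]
    gcongr 1
    rw [show (v - x) - (w - y) = (v - w) - (x - y) by abel]
    exact sq_le_sq' (by linarith [norm_sub_norm_le (x - y) (v - w), norm_sub_rev (x - y) (v - w)])
      (norm_sub_norm_le _ _)
  · refine Integrable.of_bound (by fun_prop) ((‖G‖ + |r|) ^ 2)
      (Filter.Eventually.of_forall fun σ => ?_)
    rw [Real.norm_of_nonneg (by positivity)]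
    gcongr
    refine (norm_add_le _ _).trans ?_
    simp [norm_smul]
  · exact Filter.Eventually.of_forall fun σ => by positivity

lemma ofReal_norm_sq {V : Type*} [SeminormedAddCommGroup V] (v : V) :
    ENNReal.ofReal (‖v‖ ^ 2) = ‖v‖ₑ ^ 2 := by
  rw [ENNReal.ofReal_pow (norm_nonneg _), ofReal_norm]

lemma memLp_two_of_lintegral_sq {Ω : Type*} [MeasurableSpace Ω] {μ : Measure Ω} {g : Ω → Vel}
    (hg : Measurable g) (h : ∫⁻ x, ‖g x‖ₑ ^ 2 ∂μ < ∞) : MemLp g 2 μ := by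
  refine ⟨hg.aestronglyMeasurable, ?_⟩
  rw [eLpNorm_lt_top_iff_lintegral_rpow_enorm_lt_top (by norm_num) (by norm_num)]
  simpa using h

lemma integrable_norm_sq {Ω : Type*} [MeasurableSpace Ω] {μ : Measure Ω} {g : Ω → Vel}
    (hg : MemLp g 2 μ) : Integrable (fun x => ‖g x‖ ^ 2) μ :=
  (memLp_two_iff_integrable_sq_norm hg.aestronglyMeasurable).1 hg

lemma lintegral_sq_eq {Ω : Type*} [MeasurableSpace Ω] {μ : Measure Ω} {g : Ω → Vel}
    (hg : MemLp g 2 μ) : ∫⁻ x, ‖g x‖ₑ ^ 2 ∂μ = ENNReal.ofReal (∫ x, ‖g x‖ ^ 2 ∂μ) := by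
  rw [ofReal_integral_eq_lintegral_ofReal (integrable_norm_sq hg)
    (Filter.Eventually.of_forall fun _ => by positivity)]
  simp_rw [ofReal_norm_sq]

lemma quadratic_form_eq (e : ℝ) (A B : Vel) :
    ‖((3 - e) / 4) • A + ((1 + e) / 4) • B‖ ^ 2 + ((1 + e) / 4) ^ 2 * ‖A - B‖ ^ 2 =
      (((3 - e) / 4) ^ 2 + ((1 + e) / 4) ^ 2) * ‖A‖ ^ 2 + 2 * ((1 + e) / 4) ^ 2 * ‖B‖ ^ 2 +
        (1 - e ^ 2) / 4 * inner ℝ A B := by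
  rw [norm_add_sq_real, norm_sub_sq_real, norm_smul, norm_smul, inner_smul_left, inner_smul_right,
    mul_pow, mul_pow, Real.norm_eq_abs, Real.norm_eq_abs, sq_abs, sq_abs]
  simp only [conj_trivial]
  ring

variable {e : ℝ}

/-! ### Energy and mean velocity of the Wild terms -/

section Energy

lemma postVel_zero_zero (σ : S2) : postVel e 0 0 σ = 0 := by simp [postVel]

/-- A collision of pairs whose second components are at rest leaves these at rest, so the cost
estimate contains the energy estimate; the weights sum to one. -/
lemma lintegral_energy_gain (he0 : 0 ≤ e) (he1 : e ≤ 1) (μ ν : Measure Vel)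
    [IsProbabilityMeasure μ] [IsProbabilityMeasure ν] :
    ∫⁻ v, ‖v‖ₑ ^ 2 ∂(gain unifSphere (postVel e) μ ν) ≤
      ENNReal.ofReal ((3 - e) / 4) * ∫⁻ v, ‖v‖ₑ ^ 2 ∂μ +
        ENNReal.ofReal ((1 + e) / 4) * ∫⁻ v, ‖v‖ₑ ^ 2 ∂ν := by
  have hpt (v w : Vel) : ∫⁻ σ : S2, ‖postVel e v w σ‖ₑ ^ 2 ∂unifSphere ≤
      ENNReal.ofReal ((3 - e) / 4) * ‖v‖ₑ ^ 2 + ENNReal.ofReal ((1 + e) / 4) * ‖w‖ₑ ^ 2 := by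
    have h := lintegral_enorm_postVel_sub e v w 0 0
    simp only [postVel_zero_zero, sub_zero] at h
    refine h.trans ?_
    rw [quadratic_form_eq, ← ofReal_norm_sq, ← ofReal_norm_sq,
      ← ENNReal.ofReal_mul (by linarith), ← ENNReal.ofReal_mul (by linarith),
      ← ENNReal.ofReal_add (mul_nonneg (by linarith) (by positivity))
        (mul_nonneg (by linarith) (by positivity))]
    refine ENNReal.ofReal_le_ofReal ?_
    have h1 : inner ℝ v w ≤ (‖v‖ ^ 2 + ‖w‖ ^ 2) / 2 := by
      have := real_inner_le_norm v w
      nlinarith [sq_nonneg (‖v‖ - ‖w‖)]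
    have h2 : 0 ≤ (1 - e ^ 2) / 4 := by nlinarith
    have h3 := mul_le_mul_of_nonneg_left h1 h2
    linear_combination h3
  rw [lintegral_gain (measurable_postVel e) _ _ (by fun_prop)]
  refine (lintegral_mono fun v => lintegral_mono fun w => hpt v w).trans (le_of_eq ?_)
  have hm : Measurable fun v : Vel => ‖v‖ₑ ^ 2 := by fun_prop
  simp_rw [lintegral_add_left measurable_const, lintegral_const_mul _ hm, lintegral_const]
  rw [lintegral_add_right _ measurable_const]
  simp [lintegral_const_mul _ hm]

lemma lintegral_energy_wild_le (he0 : 0 ≤ e) (he1 : e ≤ 1) (μ : Measure Vel)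
    [IsProbabilityMeasure μ] (n : ℕ) :
    ∫⁻ v, ‖v‖ₑ ^ 2 ∂(wild unifSphere (postVel e) μ n) ≤ ∫⁻ v, ‖v‖ₑ ^ 2 ∂μ := by
  have := isProbabilityMeasure_wild (U := unifSphere) (measurable_postVel e) μ
  induction n using Nat.strong_induction_on with
  | _ n ih =>
    cases n with
    | zero => rw [wild_zero]
    | succ n =>
      rw [lintegral_wild_succ]
      have h : ∀ k ∈ Finset.range (n + 1), ∫⁻ v, ‖v‖ₑ ^ 2 ∂(gain unifSphere (postVel e)
          (wild unifSphere (postVel e) μ k) (wild unifSphere (postVel e) μ (n - k))) ≤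
          ∫⁻ v, ‖v‖ₑ ^ 2 ∂μ := by
        intro k hk
        refine (lintegral_energy_gain he0 he1 _ _).trans ?_
        calc _ ≤ ENNReal.ofReal ((3 - e) / 4) * ∫⁻ v, ‖v‖ₑ ^ 2 ∂μ +
              ENNReal.ofReal ((1 + e) / 4) * ∫⁻ v, ‖v‖ₑ ^ 2 ∂μ :=
              add_le_add (mul_le_mul_right (ih k (by simpa using hk)) _)
                (mul_le_mul_right (ih (n - k) (by omega)) _)
          _ = _ := by
              rw [← add_mul, ← ENNReal.ofReal_add (by linarith) (by linarith),
                show (3 - e) / 4 + (1 + e) / 4 = 1 by ring, ENNReal.ofReal_one, one_mul]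
      calc _ ≤ ((n + 1 : ℕ) : ℝ≥0∞)⁻¹ * ∑ k ∈ Finset.range (n + 1), ∫⁻ v, ‖v‖ₑ ^ 2 ∂μ :=
            mul_le_mul_right (Finset.sum_le_sum h) _
        _ = _ := by
            rw [Finset.sum_const, Finset.card_range, nsmul_eq_mul, ← mul_assoc,
              ENNReal.inv_mul_cancel (by simp) (by simp), one_mul]

lemma memLp_id_wild (he0 : 0 ≤ e) (he1 : e ≤ 1) (μ : Measure Vel)
    [IsProbabilityMeasure μ] (hμ : FiniteEnergy μ) (n : ℕ) :
    MemLp (fun v : Vel => v) 2 (wild unifSphere (postVel e) μ n) :=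
  memLp_two_of_lintegral_sq measurable_id
    ((lintegral_energy_wild_le he0 he1 μ n).trans_lt hμ)

lemma finiteEnergy_wildSum (he0 : 0 ≤ e) (he1 : e ≤ 1) {E τ : ℝ} (hE : 0 ≤ E) (hτ : 0 ≤ τ)
    (μ : Measure Vel) [IsProbabilityMeasure μ] (hμ : FiniteEnergy μ) :
    FiniteEnergy (wildSum unifSphere (postVel e) E μ τ) := by
  rw [FiniteEnergy, lintegral_wildSum]
  refine lt_of_le_of_lt (ENNReal.tsum_le_tsum fun n =>
    mul_le_mul_right (lintegral_energy_wild_le he0 he1 μ n) _) ?_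
  rw [ENNReal.tsum_mul_right, tsum_ofReal_wildWeight hE hτ, one_mul]
  exact hμ

end Energy

section Mean

lemma meanVel_gain (he0 : 0 ≤ e) (he1 : e ≤ 1) (μ ν : Measure Vel)
    [IsProbabilityMeasure μ] [IsProbabilityMeasure ν] (hμ : FiniteEnergy μ) (hν : FiniteEnergy ν) :
    Integrable (fun v : Vel => v) (gain unifSphere (postVel e) μ ν) ∧
    meanVel (gain unifSphere (postVel e) μ ν) =
      ((3 - e) / 4) • meanVel μ + ((1 + e) / 4) • meanVel ν := by
  have := isProbabilityMeasure_gain (U := unifSphere) (measurable_postVel e) μ ν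
  have hi : Integrable (fun v : Vel => v) (gain unifSphere (postVel e) μ ν) :=
    (memLp_two_of_lintegral_sq measurable_id ((lintegral_energy_gain he0 he1 μ ν).trans_lt
      (ENNReal.add_lt_top.2 ⟨ENNReal.mul_lt_top ENNReal.ofReal_lt_top hμ,
        ENNReal.mul_lt_top ENNReal.ofReal_lt_top hν⟩))).integrable one_le_two
  have hiμ : Integrable (fun v : Vel => v) μ :=
    (memLp_two_of_lintegral_sq measurable_id hμ).integrable one_le_two
  have hiν : Integrable (fun v : Vel => v) ν :=
    (memLp_two_of_lintegral_sq measurable_id hν).integrable one_le_two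
  refine ⟨hi, ?_⟩
  have hi' : Integrable (fun p : (Vel × Vel) × S2 => postVel e p.1.1 p.1.2 p.2)
      ((μ.prod ν).prod unifSphere) :=
    (integrable_map_measure (by fun_prop) (measurable_postVel e).aemeasurable).1 hi
  have hσ (v w : Vel) : ∫ σ : S2, postVel e v w σ ∂unifSphere =
      ((3 - e) / 4) • v + ((1 + e) / 4) • w := by
    have h (σ : S2) : postVel e v w σ = (((3 - e) / 4) • v + ((1 + e) / 4) • w) +
        ((1 + e) / 4 * ‖v - w‖) • (σ : Vel) := by
      rw [postVel]
      module
    have hi : Integrable (fun σ : S2 => ((1 + e) / 4 * ‖v - w‖) • (σ : Vel)) unifSphere :=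
      Integrable.smul ((1 + e) / 4 * ‖v - w‖) integrable_coe_unifSphere
    simp_rw [h]
    rw [integral_add (integrable_const _) hi, integral_smul,
      integral_unifSphere_coe]
    simp
  rw [meanVel, gain, integral_map (measurable_postVel e).aemeasurable (by fun_prop),
    integral_prod _ hi']
  have hμν : Integrable (fun z : Vel × Vel => ((3 - e) / 4) • z.1) (μ.prod ν) :=
    Integrable.smul ((3 - e) / 4) (hiμ.comp_fst ν)
  have hνμ : Integrable (fun z : Vel × Vel => ((1 + e) / 4) • z.2) (μ.prod ν) :=
    Integrable.smul ((1 + e) / 4) (hiν.comp_snd μ)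
  simp_rw [hσ]
  rw [integral_add hμν hνμ, integral_smul, integral_smul, integral_fun_fst fun v : Vel => v,
    integral_fun_snd fun v : Vel => v]
  simp [meanVel]

/-- The mean velocity is conserved, because the weights `(3 - e)/4` and `(1 + e)/4` add up to one. -/
lemma meanVel_wild (he0 : 0 ≤ e) (he1 : e ≤ 1) (μ : Measure Vel)
    [IsProbabilityMeasure μ] (hμ : FiniteEnergy μ) (n : ℕ) :
    meanVel (wild unifSphere (postVel e) μ n) = meanVel μ := by
  have := isProbabilityMeasure_wild (U := unifSphere) (measurable_postVel e) μ
  have hfe (n : ℕ) : FiniteEnergy (wild unifSphere (postVel e) μ n) :=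
    (lintegral_energy_wild_le he0 he1 μ n).trans_lt hμ
  induction n using Nat.strong_induction_on with
  | _ n ih =>
    cases n with
    | zero => rw [wild_zero]
    | succ n =>
      rw [meanVel, wild_succ, integral_smul_measure, integral_finsetSum_measure
        fun k _ => (meanVel_gain he0 he1 _ _ (hfe k) (hfe (n - k))).1]
      have h : ∀ k ∈ Finset.range (n + 1), ∫ v, v ∂(gain unifSphere (postVel e)
          (wild unifSphere (postVel e) μ k) (wild unifSphere (postVel e) μ (n - k))) =
          meanVel μ := by
        intro k hk
        have h := (meanVel_gain he0 he1 _ _ (hfe k) (hfe (n - k))).2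
        rw [ih k (by simpa using hk), ih (n - k) (by omega), ← add_smul,
          show (3 - e) / 4 + (1 + e) / 4 = 1 by ring, one_smul] at h
        exact h
      have hn : ((n + 1 : ℕ) : ℝ) ≠ 0 := by positivity
      rw [Finset.sum_congr rfl h, Finset.sum_const, Finset.card_range, ENNReal.toReal_inv,
        ENNReal.toReal_natCast, ← Nat.cast_smul_eq_nsmul ℝ, smul_smul, inv_mul_cancel₀ hn, one_smul]

end Mean

/-! ### The cost of a coupled collision -/

section Cost

lemma integral_prod_quadratic {Ω Ω' : Type*} [MeasurableSpace Ω] [MeasurableSpace Ω']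
    {μ : Measure Ω} {ν : Measure Ω'} [IsProbabilityMeasure μ] [IsProbabilityMeasure ν]
    {g : Ω → Vel} {h : Ω' → Vel} (hg : MemLp g 2 μ) (hh : MemLp h 2 ν) (α β γ : ℝ) :
    Integrable (fun z : Ω × Ω' =>
      α * ‖g z.1‖ ^ 2 + β * ‖h z.2‖ ^ 2 + γ * inner ℝ (g z.1) (h z.2)) (μ.prod ν) ∧
    ∫ z : Ω × Ω', (α * ‖g z.1‖ ^ 2 + β * ‖h z.2‖ ^ 2 + γ * inner ℝ (g z.1) (h z.2)) ∂(μ.prod ν) =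
      α * ∫ x, ‖g x‖ ^ 2 ∂μ + β * ∫ y, ‖h y‖ ^ 2 ∂ν +
        γ * inner ℝ (∫ x, g x ∂μ) (∫ y, h y ∂ν) := by
  have hA : Integrable (fun z : Ω × Ω' => ‖g z.1‖ ^ 2) (μ.prod ν) :=
    (integrable_norm_sq hg).comp_fst ν
  have hB : Integrable (fun z : Ω × Ω' => ‖h z.2‖ ^ 2) (μ.prod ν) :=
    (integrable_norm_sq hh).comp_snd μ
  have hAB : Integrable (fun z : Ω × Ω' => inner ℝ (g z.1) (h z.2)) (μ.prod ν) := by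
    refine (hA.add hB).mono'
      (hg.aestronglyMeasurable.comp_fst.inner hh.aestronglyMeasurable.comp_snd)
      (Filter.Eventually.of_forall fun z => ?_)
    refine (norm_inner_le_norm _ _).trans ?_
    simp only [Pi.add_apply]
    nlinarith [sq_nonneg (‖g z.1‖ - ‖h z.2‖), sq_nonneg ‖g z.1‖, sq_nonneg ‖h z.2‖]
  refine ⟨((hA.const_mul α).add (hB.const_mul β)).add (hAB.const_mul γ), ?_⟩
  have hin (x : Ω) : ∫ y, inner ℝ (g x) (h y) ∂ν = inner ℝ (∫ y, h y ∂ν) (g x) := by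
    rw [integral_inner (hh.integrable one_le_two), real_inner_comm]
  have hsum : Integrable (fun z : Ω × Ω' => α * ‖g z.1‖ ^ 2 + β * ‖h z.2‖ ^ 2) (μ.prod ν) :=
    (hA.const_mul α).add (hB.const_mul β)
  rw [integral_add hsum (hAB.const_mul γ),
    integral_add (hA.const_mul α) (hB.const_mul β), integral_const_mul, integral_const_mul,
    integral_const_mul, integral_fun_fst (fun x => ‖g x‖ ^ 2), integral_fun_snd
    (fun y => ‖h y‖ ^ 2), integral_prod _ hAB]
  simp_rw [hin]
  rw [integral_inner (hg.integrable one_le_two), real_inner_comm]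
  simp

/-- The cost after one coupled collision. The cross term only sees the mean differences, because the
two colliding pairs are independent. -/
lemma lintegral_cost_gain_le (π π' : Measure (Vel × Vel))
    [IsProbabilityMeasure π] [IsProbabilityMeasure π']
    (h : MemLp (fun p : Vel × Vel => p.1 - p.2) 2 π)
    (h' : MemLp (fun p : Vel × Vel => p.1 - p.2) 2 π') :
    ∫⁻ p, ‖p.1 - p.2‖ₑ ^ 2 ∂(gain unifSphere (pairVel e) π π') ≤
      ENNReal.ofReal ((((3 - e) / 4) ^ 2 + ((1 + e) / 4) ^ 2) * ∫ p, ‖p.1 - p.2‖ ^ 2 ∂π +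
        2 * ((1 + e) / 4) ^ 2 * ∫ p, ‖p.1 - p.2‖ ^ 2 ∂π' +
        (1 - e ^ 2) / 4 * inner ℝ (∫ p, (p.1 - p.2) ∂π) (∫ p, (p.1 - p.2) ∂π')) := by
  obtain ⟨hi, hint⟩ := integral_prod_quadratic h h' (((3 - e) / 4) ^ 2 + ((1 + e) / 4) ^ 2)
    (2 * ((1 + e) / 4) ^ 2) ((1 - e ^ 2) / 4)
  rw [lintegral_gain (measurable_pairVel e) _ _ (by fun_prop), ← hint,
    ofReal_integral_eq_lintegral_ofReal hi (Filter.Eventually.of_forall fun z => ?_),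
    lintegral_prod _ hi.aestronglyMeasurable.aemeasurable.ennreal_ofReal]
  · refine lintegral_mono fun P => lintegral_mono fun Q => ?_
    have := lintegral_enorm_postVel_sub e P.1 Q.1 P.2 Q.2
    rwa [quadratic_form_eq] at this
  · simp only [Pi.zero_apply]
    rw [← quadratic_form_eq]
    exact add_nonneg (sq_nonneg _) (mul_nonneg (sq_nonneg _) (sq_nonneg _))

end Cost

/-! ### Summation of the Wild series -/

section Series

lemma succ_mul_multichoose (b : ℝ) (n : ℕ) :
    ((n + 1 : ℕ) : ℝ) * Ring.multichoose b (n + 1) = (b + n) * Ring.multichoose b n := by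
  have h1 := Ring.factorial_nsmul_multichoose_eq_ascPochhammer b (n + 1)
  have h0 := Ring.factorial_nsmul_multichoose_eq_ascPochhammer b n
  rw [Polynomial.ascPochhammer_smeval_eq_eval, nsmul_eq_mul] at h0 h1
  rw [ascPochhammer_succ_eval, ← h0, Nat.factorial_succ, Nat.cast_mul] at h1
  have hn : (n.factorial : ℝ) ≠ 0 := by positivity
  apply mul_left_cancel₀ hn
  linear_combination h1

lemma sum_range_multichoose (b : ℝ) (n : ℕ) :
    b * ∑ k ∈ Finset.range (n + 1), Ring.multichoose b k =
      ((n + 1 : ℕ) : ℝ) * Ring.multichoose b (n + 1) := by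
  induction n with
  | zero => rw [succ_mul_multichoose]; simp
  | succ n ih =>
    rw [Finset.sum_range_succ, mul_add, ih, succ_mul_multichoose b (n + 1)]
    ring

lemma hasSum_multichoose (b : ℝ) {z : ℝ} (hz : z ∈ Ico (0 : ℝ) 1) :
    HasSum (fun n => z ^ n * Ring.multichoose b n) (1 / (1 - z) ^ b) := by
  have h := (Real.one_div_one_sub_rpow_hasFPowerSeriesOnBall_zero b).hasSum (y := z)
    (by simpa [abs_of_nonneg hz.1, enorm_eq_nnnorm, ← NNReal.coe_lt_coe] using hz.2)
  simp only [FormalMultilinearSeries.ofScalars_apply_eq, zero_add, smul_eq_mul] at h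
  have hfun : (fun n => z ^ n * Ring.multichoose b n) =
      fun n : ℕ => Ring.choose (b + n - 1) n * z ^ n := by
    ext n
    rw [mul_comm, Ring.choose, show b + n - 1 - n + 1 = b by ring]
  rw [hfun]
  exact h

/-- Comparison with the exact solution `d + (m 0 - d) cₙ`, where `cₙ` are the coefficients of
`(1 - z)^{-b}`; no sign of `m 0 - d` is needed, since all coefficients in the recursion are
nonnegative. -/
lemma le_of_averaged_recursion {b d : ℝ} (hb : 0 ≤ b) {m : ℕ → ℝ}
    (hm : ∀ n, ((n + 1 : ℕ) : ℝ) * m (n + 1) ≤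
      b * ∑ k ∈ Finset.range (n + 1), m k + (n + 1 : ℕ) * ((1 - b) * d)) (n : ℕ) :
    m n ≤ d + (m 0 - d) * Ring.multichoose b n := by
  induction n using Nat.strong_induction_on with
  | _ n ih =>
    cases n with
    | zero => simp
    | succ n =>
      have hn : (0 : ℝ) < ((n + 1 : ℕ) : ℝ) := by positivity
      refine le_of_mul_le_mul_left ?_ hn
      refine (hm n).trans ?_
      have h : ∑ k ∈ Finset.range (n + 1), m k ≤
          ∑ k ∈ Finset.range (n + 1), (d + (m 0 - d) * Ring.multichoose b k) :=
        Finset.sum_le_sum fun k hk => ih k (by simpa using hk)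
      rw [Finset.sum_add_distrib, ← Finset.mul_sum, Finset.sum_const, Finset.card_range,
        nsmul_eq_mul] at h
      have h2 := mul_le_mul_of_nonneg_left h hb
      linear_combination h2 + (m 0 - d) * sum_range_multichoose b n

lemma tsum_wildWeight_le {b d E τ : ℝ} (hb : 0 ≤ b) (hE : 0 ≤ E) (hτ : 0 ≤ τ) {m : ℕ → ℝ}
    (hm0 : ∀ n, 0 ≤ m n)
    (hm : ∀ n, ((n + 1 : ℕ) : ℝ) * m (n + 1) ≤
      b * ∑ k ∈ Finset.range (n + 1), m k + (n + 1 : ℕ) * ((1 - b) * d)) :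
    ∑' n, ENNReal.ofReal (wildWeight E τ n) * ENNReal.ofReal (m n) ≤
      ENNReal.ofReal (Real.exp (-((1 - b) * E * τ)) * m 0 +
        (1 - Real.exp (-((1 - b) * E * τ))) * d) := by
  have hz := wildWeight_base_mem hE hτ
  have hle := le_of_averaged_recursion hb hm
  have hsum : HasSum (fun n => wildWeight E τ n * (d + (m 0 - d) * Ring.multichoose b n))
      (Real.exp (-((1 - b) * E * τ)) * m 0 + (1 - Real.exp (-((1 - b) * E * τ))) * d) := by
    have h := ((hasSum_wildWeight hE hτ).mul_right d).add
      ((hasSum_multichoose b hz).mul_left (Real.exp (-(E * τ)) * (m 0 - d)))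
    have hexp : Real.exp (-(E * τ)) * (1 / (1 - (1 - Real.exp (-(E * τ)))) ^ b) =
        Real.exp (-((1 - b) * E * τ)) := by
      rw [sub_sub_cancel, ← Real.exp_mul, one_div, ← Real.exp_neg, ← Real.exp_add]
      congr 1
      ring
    have hval : Real.exp (-((1 - b) * E * τ)) * m 0 + (1 - Real.exp (-((1 - b) * E * τ))) * d =
        1 * d + Real.exp (-(E * τ)) * (m 0 - d) *
          (1 / (1 - (1 - Real.exp (-(E * τ)))) ^ b) := by
      linear_combination (d - m 0) * hexp
    rw [hval]
    have hfun : (fun n => wildWeight E τ n * (d + (m 0 - d) * Ring.multichoose b n)) =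
        fun n => wildWeight E τ n * d + Real.exp (-(E * τ)) * (m 0 - d) *
          ((1 - Real.exp (-(E * τ))) ^ n * Ring.multichoose b n) := by
      ext n
      simp only [wildWeight]
      ring
    rw [hfun]
    exact h
  rw [← hsum.tsum_eq, ENNReal.ofReal_tsum_of_nonneg
    (fun n => mul_nonneg (wildWeight_nonneg hE hτ n) ((hm0 n).trans (hle n))) hsum.summable]
  refine ENNReal.tsum_le_tsum fun n => ?_
  rw [← ENNReal.ofReal_mul (wildWeight_nonneg hE hτ n)]
  exact ENNReal.ofReal_le_ofReal (mul_le_mul_of_nonneg_left (hle n) (wildWeight_nonneg hE hτ n))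

end Series

/-! ### The coupled dynamics -/

section Coupling

variable {e : ℝ}

lemma IsCoupling.isProbabilityMeasure {π : Measure (Vel × Vel)} {f g : Measure Vel}
    [IsProbabilityMeasure f] (h : IsCoupling π f g) : IsProbabilityMeasure π :=
  ⟨by rw [← measure_univ (μ := f), ← h.1, Measure.map_apply measurable_fst .univ, preimage_univ]⟩

lemma IsCoupling.pair_wild {π : Measure (Vel × Vel)} {f g : Measure Vel} [IsProbabilityMeasure f]
    (h : IsCoupling π f g) (n : ℕ) :
    IsCoupling (wild unifSphere (pairVel e) π n) (wild unifSphere (postVel e) f n)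
      (wild unifSphere (postVel e) g n) := by
  have := h.isProbabilityMeasure
  constructor
  · rw [wild_map (measurable_pairVel e) (measurable_postVel e) measurable_fst
      (fun _ _ _ => rfl), h.1]
  · rw [wild_map (measurable_pairVel e) (measurable_postVel e) measurable_snd
      (fun _ _ _ => rfl), h.2]

lemma IsCoupling.pair_wildSum {π : Measure (Vel × Vel)} {f g : Measure Vel} [IsProbabilityMeasure f]
    (h : IsCoupling π f g) (E τ : ℝ) :
    IsCoupling (wildSum unifSphere (pairVel e) E π τ) (wildSum unifSphere (postVel e) E f τ)
      (wildSum unifSphere (postVel e) E g τ) := by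
  have := h.isProbabilityMeasure
  constructor
  · rw [wildSum_map (measurable_pairVel e) (measurable_postVel e) measurable_fst
      (fun _ _ _ => rfl), h.1]
  · rw [wildSum_map (measurable_pairVel e) (measurable_postVel e) measurable_snd
      (fun _ _ _ => rfl), h.2]

lemma IsCoupling.memLp {π : Measure (Vel × Vel)} {f g : Measure Vel}
    (h : IsCoupling π f g) (hf : MemLp (fun v : Vel => v) 2 f)
    (hg : MemLp (fun v : Vel => v) 2 g) :
    MemLp (fun p : Vel × Vel => p.1) 2 π ∧ MemLp (fun p : Vel × Vel => p.2) 2 π := by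
  rw [← h.1] at hf
  rw [← h.2] at hg
  exact ⟨hf.comp_of_map measurable_fst.aemeasurable, hg.comp_of_map measurable_snd.aemeasurable⟩

lemma IsCoupling.integral_sub {π : Measure (Vel × Vel)} {f g : Measure Vel}
    [IsProbabilityMeasure f] (h : IsCoupling π f g) (hf : MemLp (fun v : Vel => v) 2 f)
    (hg : MemLp (fun v : Vel => v) 2 g) :
    ∫ p, (p.1 - p.2) ∂π = meanVel f - meanVel g := by
  have := h.isProbabilityMeasure
  obtain ⟨h1, h2⟩ := h.memLp hf hg
  have e1 : ∫ p : Vel × Vel, p.1 ∂π = meanVel f := by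
    rw [meanVel, ← h.1, integral_map (by fun_prop) (by fun_prop)]
  have e2 : ∫ p : Vel × Vel, p.2 ∂π = meanVel g := by
    rw [meanVel, ← h.2, integral_map (by fun_prop) (by fun_prop)]
  rw [MeasureTheory.integral_sub (h1.integrable one_le_two) (h2.integrable one_le_two), e1, e2]

/-- The contraction estimate for the coupling that the coupled dynamics transports from `π`. -/
theorem IsCoupling.lintegral_cost_wildSum_le (he0 : 0 < e) (he1 : e < 1)
    {π : Measure (Vel × Vel)} {f g : Measure Vel} [IsProbabilityMeasure f]
    [IsProbabilityMeasure g] (h : IsCoupling π f g) (hf : FiniteEnergy f) (hg : FiniteEnergy g)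
    {τ : ℝ} (hτ : 0 ≤ τ) :
    ∫⁻ p, ‖p.1 - p.2‖ₑ ^ 2 ∂(wildSum unifSphere (pairVel e) (rate e) π τ) ≤
      ENNReal.ofReal (Real.exp (-2 * τ)) * ∫⁻ p, ‖p.1 - p.2‖ₑ ^ 2 ∂π +
        ENNReal.ofReal ((1 - Real.exp (-2 * τ)) * ‖meanVel f - meanVel g‖ ^ 2) := by
  have := h.isProbabilityMeasure
  have he2 : 0 < 1 - e ^ 2 := by nlinarith
  have hE : 0 ≤ rate e := by rw [rate]; positivity
  set W := wild unifSphere (pairVel e) π with hW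
  have hWp : ∀ n, IsProbabilityMeasure (W n) := isProbabilityMeasure_wild (measurable_pairVel e) π
  have hfp := isProbabilityMeasure_wild (U := unifSphere) (measurable_postVel e) f
  have hf2 := memLp_id_wild he0.le he1.le f hf
  have hg2 := memLp_id_wild he0.le he1.le g hg
  have hc (n : ℕ) := h.pair_wild (e := e) n
  have hL (n : ℕ) : MemLp (fun p : Vel × Vel => p.1 - p.2) 2 (W n) :=
    ((hc n).memLp (hf2 n) (hg2 n)).1.sub ((hc n).memLp (hf2 n) (hg2 n)).2
  set D : Vel := meanVel f - meanVel g with hD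
  have hmean (n : ℕ) : ∫ p, (p.1 - p.2) ∂(W n) = D := by
    rw [(hc n).integral_sub (hf2 n) (hg2 n), meanVel_wild he0.le he1.le f hf,
      meanVel_wild he0.le he1.le g hg]
  set m : ℕ → ℝ := fun n => ∫ p, ‖p.1 - p.2‖ ^ 2 ∂(W n) with hm
  have hm0 (n : ℕ) : 0 ≤ m n := integral_nonneg fun p => by positivity
  have hml (n : ℕ) : ∫⁻ p, ‖p.1 - p.2‖ₑ ^ 2 ∂(W n) = ENNReal.ofReal (m n) := lintegral_sq_eq (hL n)
  set α : ℝ := ((3 - e) / 4) ^ 2 + ((1 + e) / 4) ^ 2 with hα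
  set β : ℝ := 2 * ((1 + e) / 4) ^ 2 with hβ
  have hα0 : 0 ≤ α := by positivity
  have hβ0 : 0 ≤ β := by positivity
  have hκ : 1 - (α + β) = (1 - e ^ 2) / 4 := by rw [hα, hβ]; ring
  have hrec (n : ℕ) : ((n + 1 : ℕ) : ℝ) * m (n + 1) ≤
      (α + β) * ∑ k ∈ Finset.range (n + 1), m k + (n + 1 : ℕ) * ((1 - (α + β)) * ‖D‖ ^ 2) := by
    have hn : (0 : ℝ) < ((n + 1 : ℕ) : ℝ) := by positivity
    have hpos (k l : ℕ) : 0 ≤ α * m k + β * m l + (1 - (α + β)) * ‖D‖ ^ 2 := by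
      have := hm0 k
      have := hm0 l
      rw [hκ]
      positivity
    have hS : ∑ k ∈ Finset.range (n + 1), (α * m k + β * m (n - k) + (1 - (α + β)) * ‖D‖ ^ 2) =
        (α + β) * ∑ k ∈ Finset.range (n + 1), m k + (n + 1 : ℕ) * ((1 - (α + β)) * ‖D‖ ^ 2) := by
      have := Finset.sum_range_reflect m (n + 1)
      simp only [Nat.add_sub_cancel] at this
      rw [Finset.sum_add_distrib, Finset.sum_add_distrib, ← Finset.mul_sum, ← Finset.mul_sum,
        this, Finset.sum_const, Finset.card_range, nsmul_eq_mul]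
      ring
    rw [← hS, ← ENNReal.ofReal_le_ofReal_iff (Finset.sum_nonneg fun k _ => hpos k _),
      ENNReal.ofReal_sum_of_nonneg fun k _ => hpos k _, ENNReal.ofReal_mul hn.le, ← hml,
      lintegral_wild_succ, ENNReal.ofReal_natCast, ← mul_assoc,
      ENNReal.mul_inv_cancel (by simp) (by simp), one_mul]
    refine Finset.sum_le_sum fun k _ => ?_
    have hk := lintegral_cost_gain_le (e := e) (W k) (W (n - k)) (hL k) (hL (n - k))
    rwa [hmean, hmean, real_inner_self_eq_norm_sq, ← hκ] at hk
  have hmain := tsum_wildWeight_le (add_nonneg hα0 hβ0) hE hτ hm0 hrec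
  -- the exponent: `κ E = 2`
  have hrate : (1 - (α + β)) * rate e * τ = 2 * τ := by
    rw [hκ, rate]
    field_simp
    ring
  rw [hrate, ← neg_mul] at hmain
  have hexp : Real.exp (-2 * τ) ≤ 1 := Real.exp_le_one_iff.2 (by linarith)
  have hπ := hml 0
  rw [show W 0 = π from wild_zero π] at hπ
  rw [lintegral_wildSum]
  simp_rw [← hW, hml]
  refine hmain.trans (le_of_eq ?_)
  rw [ENNReal.ofReal_add (mul_nonneg (Real.exp_pos _).le (hm0 0))
    (mul_nonneg (by linarith) (by positivity)), ENNReal.ofReal_mul (Real.exp_pos _).le, hπ]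

lemma W2_sq (f g : Measure Vel) :
    W2 f g ^ 2 = ⨅ (π : Measure (Vel × Vel)) (_ : IsCoupling π f g),
      ∫⁻ p, ‖p.1 - p.2‖ₑ ^ 2 ∂π := by
  rw [W2, ← ENNReal.rpow_natCast, ← ENNReal.rpow_mul]
  norm_num

end Coupling

end InelasticMaxwell

end

theorem theorem3p1
    (e : ℝ) (he0 : 0 < e) (he1 : e < 1)
    (f₁₀ f₂₀ : ProbabilityMeasure InelasticMaxwell.Vel)
    (hf₁₀ : InelasticMaxwell.FiniteEnergy f₁₀) (hf₂₀ : InelasticMaxwell.FiniteEnergy f₂₀)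
    (f₁ f₂ : ℝ → ProbabilityMeasure InelasticMaxwell.Vel)
    (hf₁ : InelasticMaxwell.IsSolution e f₁₀ f₁) (hf₂ : InelasticMaxwell.IsSolution e f₂₀ f₂) :
    ∀ τ : ℝ, 0 ≤ τ →
      InelasticMaxwell.FiniteEnergy (f₁ τ) ∧ InelasticMaxwell.FiniteEnergy (f₂ τ) ∧
      InelasticMaxwell.W2 (f₁ τ) (f₂ τ) ^ 2 ≤
        ENNReal.ofReal (Real.exp (-2 * τ)) * InelasticMaxwell.W2 f₁₀ f₂₀ ^ 2 +
        ENNReal.ofReal ((1 - Real.exp (-2 * τ)) *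
          ‖InelasticMaxwell.meanVel f₁₀ - InelasticMaxwell.meanVel f₂₀‖ ^ 2) := by
  open InelasticMaxwell in
  intro τ hτ
  have hE : 0 ≤ rate e := by
    have : 0 < 1 - e ^ 2 := by nlinarith
    rw [rate]
    positivity
  have h₁ := hf₁.isGainSolution.eq_wildSum (measurable_postVel e) hE hτ
  have h₂ := hf₂.isGainSolution.eq_wildSum (measurable_postVel e) hE hτ
  rw [hf₁.initial] at h₁
  rw [hf₂.initial] at h₂
  rw [h₁, h₂]
  refine ⟨finiteEnergy_wildSum he0.le he1.le hE hτ _ hf₁₀,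
    finiteEnergy_wildSum he0.le he1.le hE hτ _ hf₂₀, ?_⟩
  rw [W2_sq, W2_sq, ENNReal.mul_iInf_of_ne (by simp [Real.exp_pos]) ENNReal.ofReal_ne_top,
    ENNReal.iInf_add]
  refine le_iInf fun π => ?_
  rw [ENNReal.mul_iInf_of_ne (by simp [Real.exp_pos]) ENNReal.ofReal_ne_top, ENNReal.iInf_add]
  refine le_iInf fun hπ => ?_
  have hc := hπ.pair_wildSum (e := e) (rate e) τ
  exact (iInf₂_le (wildSum unifSphere (pairVel e) (rate e) π τ) hc).trans
    (hπ.lintegral_cost_wildSum_le he0 he1 hf₁₀ hf₂₀ hτ)
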